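/- A word $x\in\{0,1\}^*$ is \emph{totally balanced} if it contains as many $1$'s as $0$'s and every prefix of $x$ contains at least as many $1$'s as $0$'s. The \emph{nesting level} $\ell(x)$ of a totally balanced word is defined recursively by $\ell(\epsilon)=0$ and $\ell(1y0z)=\max(\ell(y)+1,\ell(z))$ for totally balanced $y,z$. The base-$2$ representation of a natural number is written most significant digit first without leading zeros, and that of $0$ is the empty word $\epsilon$. Let $S_{\rm TB}$ be the set of natural numbers whose base-$2$ representation is totally balanced, and let $L_6$ be the set of totally balanced words $x$ with $\ell(x)\le 3$. Summands need not be distinct. (1) An even natural number is the sum of at most $3$ elements of $S_{\rm TB}$ if and only if it is not one of $8, 18, 28, 38, 40, 82, 166$. (2) There are infinitely many even natural numbers that are not the sum of at most $2$ elements of $S_{\rm TB}$. (3) An even natural number is the sum of at most $3$ natural numbers whose base-$2$ representation lies in $L_6$ if and only if it is not one of $8, 18, 28, 38, 40, 82, 166$. -/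

import Mathlib

/-- A word over `{0,1}` (with `true` standing for `1` and `false` for `0`) is totally balanced if it
has as many `1`s as `0`s and no prefix of it has more `0`s than `1`s. -/
def TotallyBalanced (x : List Bool) : Prop :=
  x.count true = x.count false ∧ ∀ p : List Bool, p <+: x → p.count false ≤ p.count true

/-- `HasNestingLevel x m` says that the recursively defined nesting level `ℓ(x)` is `m`:
`ℓ(ε) = 0`, and `ℓ(1y0z) = max (ℓ(y) + 1) (ℓ(z))` for totally balanced `y` and `z`.
By `TotallyBalanced.existsUnique_nestingLevel` below this defines `ℓ` on all totally balanced
words. -/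
inductive HasNestingLevel : List Bool → ℕ → Prop
  | nil : HasNestingLevel [] 0
  | node {y z : List Bool} {a b : ℕ} (hy : TotallyBalanced y) (hz : TotallyBalanced z)
      (ha : HasNestingLevel y a) (hb : HasNestingLevel z b) :
      HasNestingLevel (true :: (y ++ false :: z)) (max (a + 1) b)

theorem TotallyBalanced.decomp_unique {y z y' z' : List Bool} (hy : TotallyBalanced y)
    (hy' : TotallyBalanced y') (h : y ++ false :: z = y' ++ false :: z') : y = y' ∧ z = z' := by
  rcases List.append_eq_append_iff.1 h with ⟨c, rfl, hc⟩ | ⟨c, rfl, hc⟩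
  · cases c with
    | nil => simp at hc; simp [hc]
    | cons d c =>
      simp only [List.cons_append, List.cons.injEq] at hc
      obtain ⟨rfl, -⟩ := hc
      have h1 := hy'.2 (y ++ [false]) ⟨c, by simp⟩
      have h2 := hy.1
      simp at h1
      omega
  · cases c with
    | nil => simp at hc; simp [hc]
    | cons d c =>
      simp only [List.cons_append, List.cons.injEq] at hc
      obtain ⟨rfl, -⟩ := hc
      have h1 := hy.2 (y' ++ [false]) ⟨c, by simp⟩
      have h2 := hy'.1
      simp at h1
      omega

theorem TotallyBalanced.exists_decomp {x : List Bool} (hx : TotallyBalanced x) (hne : x ≠ []) :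
    ∃ y z, TotallyBalanced y ∧ TotallyBalanced z ∧ x = true :: (y ++ false :: z) := by
  obtain ⟨d, w, rfl⟩ := List.exists_cons_of_ne_nil hne
  have hd : d = true := by
    have := hx.2 [d] ⟨w, rfl⟩
    cases d <;> simp_all
  subst hd
  have hex : ∃ i, (w.take i).count true < (w.take i).count false :=
    ⟨w.length, by have := hx.1; simp at this ⊢; omega⟩
  classical
  obtain ⟨i, hi, hmin⟩ : ∃ i, (w.take i).count true < (w.take i).count false ∧
      ∀ j < i, (w.take j).count false ≤ (w.take j).count true :=
    ⟨Nat.find hex, Nat.find_spec hex, fun j hj => not_lt.1 (Nat.find_min hex hj)⟩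
  cases i with
  | zero => simp at hi
  | succ k =>
    have hk : k < w.length := by
      by_contra hk
      have h1 := hmin k (by omega)
      rw [List.take_of_length_le (by omega)] at h1 hi
      omega
    have hk1 := hmin k (by omega)
    have htk : w.take (k + 1) = w.take k ++ [w[k]] := by simp
    have hwk : w[k] = false := by
      by_contra hc
      simp only [Bool.not_eq_false] at hc
      rw [htk, hc] at hi
      simp at hi
      omega
    rw [htk, hwk] at hi
    simp at hi
    have hw : w = w.take k ++ false :: w.drop (k + 1) := by
      rw [← hwk, List.getElem_cons_drop, List.take_append_drop]
    have hy : TotallyBalanced (w.take k) := by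
      refine ⟨by omega, fun p hp => ?_⟩
      have hpl := hp.length_le
      rw [List.length_take] at hpl
      have hpw : p = w.take p.length := (List.prefix_iff_eq_take.1 (hp.trans (List.take_prefix _ _)))
      rw [hpw]
      exact hmin _ (by omega)
    refine ⟨w.take k, w.drop (k + 1), hy, ?_, by rw [← hw]⟩
    have hy1 := hy.1
    generalize w.take k = y at *
    generalize w.drop (k + 1) = z at *
    clear hmin hwk htk hk
    subst hw
    refine ⟨by have := hx.1; simp at this; omega, fun p hp => ?_⟩
    obtain ⟨t, rfl⟩ := hp
    have := hx.2 (true :: (y ++ false :: p)) ⟨t, by simp⟩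
    simp at this
    omega

theorem TotallyBalanced.existsUnique_nestingLevel {x : List Bool} (hx : TotallyBalanced x) :
    ∃! m, HasNestingLevel x m := by
  induction hn : x.length using Nat.strong_induction_on generalizing x with
  | _ n ih =>
    subst hn
    by_cases hne : x = []
    · subst hne
      exact ⟨0, .nil, fun m hm => by cases hm; rfl⟩
    · obtain ⟨y, z, hy, hz, rfl⟩ := hx.exists_decomp hne
      obtain ⟨a, ha, hau⟩ := ih y.length (by simp) hy rfl
      obtain ⟨b, hb, hbu⟩ := ih z.length (by simp; omega) hz rfl
      refine ⟨_, .node hy hz ha hb, fun m hm => ?_⟩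
      generalize hw : true :: (y ++ false :: z) = w at hm
      cases hm with
      | nil => simp at hw
      | node hy' hz' ha' hb' =>
        obtain ⟨rfl, rfl⟩ := hy.decomp_unique hy' (by simpa using hw)
        rw [hau _ ha', hbu _ hb']

/-- The canonical base-2 representation of `n`, most significant digit first, without leading
zeros; the representation of `0` is the empty word. -/
def binaryWord (n : ℕ) : List Bool := n.bits.reverse

/-- The set of natural numbers whose base-2 representation is totally balanced. -/
def totallyBalancedNumbers : Set ℕ := {n | TotallyBalanced (binaryWord n)}

/-- The language of totally balanced words of nesting level at most `3`. -/
def balancedLevelThree : Language Bool :=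
  {x | TotallyBalanced x ∧ ∃ m ≤ 3, HasNestingLevel x m}

/-- `n` is the sum of at most `k` (not necessarily distinct) elements of `S`. -/
def IsSumOfAtMost (k : ℕ) (S : Set ℕ) (n : ℕ) : Prop :=
  ∃ l : List ℕ, l.length ≤ k ∧ (∀ s ∈ l, s ∈ S) ∧ l.sum = n

/-!
Cut the binary word of a number into blocks of two digits, that is, write the number in base 4.
Let `A` and `B` be the sets of numbers whose binary word, read as a path with `1` as up step and
`0` as down step, stays within the heights `0, …, 3` and ends at height `0`, respectively `2`. Then
`4a + 2, 4b ∈ A` and `4b + 1, 4b + 2, 4a + 3 ∈ B` for all `a ∈ A`, `b ∈ B`. Consider the sets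
`P = (A + B + B) ∪ (A + A + A + 1)` and `Q = (B + B + B) ∪ (A + A + B + 1)`. Adding last base-4
digits with their carry shows that `4m + 2` (`m ∈ P`) and `4m` (`m ∈ Q`) lie in `A + A + A`, and
that `4m + 3, 4m + 4` (`m ∈ P`) and `4m + 1, 4m + 2` (`m ∈ Q`) lie in `P`, while
`4m + 4, 4m + 5` (`m ∈ P`) and `4m + 2, 4m + 3` (`m ∈ Q`) lie in `Q`. As every residue modulo 4 is
covered each time, once an interval `[c, 4c + 3]` lies in `P ∩ Q` so does everything above `c`;
this happens for `c = 182`.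

For two summands: a totally balanced word has even length, so no totally balanced number lies
strictly between `2 ^ (2m)` and `2 ^ (2m + 1)`, and neither of these powers is one if `m ≥ 1`; hence
two totally balanced numbers cannot add up to `2 ^ (2m + 1)`.
-/

open scoped Pointwise

theorem binaryWord_two_mul {n : ℕ} (hn : n ≠ 0) : binaryWord (2 * n) = binaryWord n ++ [false] := by
  simp only [binaryWord, Nat.bit0_bits n hn, List.reverse_cons]

theorem binaryWord_two_mul_add_one (n : ℕ) : binaryWord (2 * n + 1) = binaryWord n ++ [true] := by
  simp only [binaryWord, Nat.bit1_bits, List.reverse_cons]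

theorem length_binaryWord (n : ℕ) : (binaryWord n).length = n.size := by
  rw [binaryWord, List.length_reverse, Nat.size_eq_bits_len]

theorem binaryWord_two_pow (k : ℕ) : binaryWord (2 ^ k) = true :: List.replicate k false := by
  induction k with
  | zero => simp [binaryWord]
  | succ k ih =>
    rw [pow_succ', binaryWord_two_mul (by positivity), ih, List.cons_append,
      ← List.replicate_succ']

namespace TotallyBalanced

instance : DecidablePred TotallyBalanced := fun x =>
  decidable_of_iff (x.count true = x.count false ∧ ∀ p ∈ x.inits, p.count false ≤ p.count true)
    (by simp only [TotallyBalanced, List.mem_inits])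

theorem even_length {x : List Bool} (hx : TotallyBalanced x) : Even x.length :=
  ⟨x.count true, by rw [← List.count_true_add_count_false x, hx.1]⟩

theorem exists_nestingLevel_le {k : ℕ} {x : List Bool} (hx : TotallyBalanced x)
    (hk : ∀ p, p <+: x → p.count true ≤ p.count false + k) : ∃ m ≤ k, HasNestingLevel x m := by
  induction hn : x.length using Nat.strong_induction_on generalizing x k with
  | _ n ih =>
    subst hn
    rcases eq_or_ne x [] with rfl | hne
    · exact ⟨0, k.zero_le, .nil⟩
    obtain ⟨y, z, hy, hz, rfl⟩ := hx.exists_decomp hne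
    have one_le : 1 ≤ k := by simpa using hk [true] ⟨y ++ false :: z, rfl⟩
    have excess_y : ∀ p, p <+: y → p.count true ≤ p.count false + (k - 1) := by
      rintro p ⟨t, rfl⟩
      have h := hk (true :: p) ⟨t ++ false :: z, by simp⟩
      simp only [List.count_cons_self, List.count_cons_of_ne, ne_eq, reduceCtorEq,
        not_false_eq_true] at h
      omega
    have excess_z : ∀ p, p <+: z → p.count true ≤ p.count false + k := by
      rintro p ⟨t, rfl⟩
      have h := hk (true :: (y ++ false :: p)) ⟨t, by simp⟩
      have hy_count := hy.1
      simp only [List.count_cons, List.count_append, beq_self_eq_true, beq_true, beq_false,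
        Bool.not_true, reduceIte, Bool.false_eq_true] at h
      omega
    obtain ⟨a, hak, ha⟩ := ih y.length (by simp) hy excess_y rfl
    obtain ⟨b, hbk, hb⟩ := ih z.length (by grind) hz excess_z rfl
    exact ⟨max (a + 1) b, by omega, .node hy hz ha hb⟩

end TotallyBalanced

/-- Read as a path with `1` as up step and `0` as down step, the word `w` leads from height `0` to
height `h` and stays within the heights `0, …, k`. -/
def IsBoundedPath (k h : ℕ) (w : List Bool) : Prop :=
  w.count true = w.count false + h ∧
    ∀ p, p <+: w → p.count false ≤ p.count true ∧ p.count true ≤ p.count false + k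

namespace IsBoundedPath

variable {k h : ℕ} {w : List Bool}

theorem append_true (hw : IsBoundedPath k h w) (hh : h < k) :
    IsBoundedPath k (h + 1) (w ++ [true]) := by
  have hcount := hw.1
  have count_true : (w ++ [true]).count true = w.count true + 1 := by simp
  have count_false : (w ++ [true]).count false = w.count false := by simp
  refine ⟨by omega, fun p hp => ?_⟩
  rcases List.prefix_concat_iff.1 hp with rfl | hp
  · omega
  · exact hw.2 p hp

theorem append_false (hw : IsBoundedPath k (h + 1) w) : IsBoundedPath k h (w ++ [false]) := by
  have hcount := hw.1
  have hbound := (hw.2 w List.prefix_rfl).2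
  have count_true : (w ++ [false]).count true = w.count true := by simp
  have count_false : (w ++ [false]).count false = w.count false + 1 := by simp
  refine ⟨by omega, fun p hp => ?_⟩
  rcases List.prefix_concat_iff.1 hp with rfl | hp
  · omega
  · exact hw.2 p hp

theorem totallyBalanced (hw : IsBoundedPath k 0 w) : TotallyBalanced w :=
  ⟨hw.1, fun p hp => (hw.2 p hp).1⟩

theorem exists_nestingLevel_le (hw : IsBoundedPath k 0 w) : ∃ m ≤ k, HasNestingLevel w m :=
  hw.totallyBalanced.exists_nestingLevel_le fun p hp => (hw.2 p hp).2

end IsBoundedPath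

/-- The numbers whose binary word is a path from height `0` to height `h` within the heights
`0, …, k`. -/
def pathNumbers (k h : ℕ) : Set ℕ := {n | IsBoundedPath k h (binaryWord n)}

namespace pathNumbers

variable {k h n : ℕ}

theorem zero_mem : 0 ∈ pathNumbers k 0 := by
  simp [pathNumbers, IsBoundedPath, binaryWord]

theorem two_mul_add_one_mem (hn : n ∈ pathNumbers k h) (hh : h < k := by omega) :
    2 * n + 1 ∈ pathNumbers k (h + 1) := by
  simpa only [pathNumbers, Set.mem_ofPred_eq, binaryWord_two_mul_add_one] using hn.append_true hh

theorem two_mul_mem (hn : n ∈ pathNumbers k (h + 1)) : 2 * n ∈ pathNumbers k h := by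
  have hne : n ≠ 0 := by
    rintro rfl
    simpa [binaryWord] using hn.1
  simpa only [pathNumbers, Set.mem_ofPred_eq, binaryWord_two_mul hne] using hn.append_false

theorem four_mul_mem (hn : n ∈ pathNumbers k (h + 2)) : 4 * n ∈ pathNumbers k h := by
  convert two_mul_mem (two_mul_mem hn) using 1
  ring

theorem four_mul_add_one_mem (hn : n ∈ pathNumbers k (h + 1)) (hh : h < k := by omega) :
    4 * n + 1 ∈ pathNumbers k (h + 1) := by
  convert two_mul_add_one_mem (two_mul_mem hn) hh using 1
  ring

theorem four_mul_add_two_mem (hn : n ∈ pathNumbers k h) (hh : h < k := by omega) :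
    4 * n + 2 ∈ pathNumbers k h := by
  convert two_mul_mem (two_mul_add_one_mem hn hh) using 1
  ring

theorem four_mul_add_three_mem (hn : n ∈ pathNumbers k h) (hh : h + 1 < k := by omega) :
    4 * n + 3 ∈ pathNumbers k (h + 2) := by
  convert two_mul_add_one_mem (two_mul_add_one_mem hn (by omega)) hh using 1
  ring

theorem subset_balancedLevelThree :
    pathNumbers 3 0 ⊆ {s | binaryWord s ∈ balancedLevelThree} :=
  fun _ hs => ⟨hs.totallyBalanced, hs.exists_nestingLevel_le⟩

end pathNumbers

theorem mem_add_add {S T U : Set ℕ} {n : ℕ} :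
    n ∈ S + T + U ↔ ∃ x ∈ S, ∃ y ∈ T, ∃ z ∈ U, x + y + z = n := by
  simp only [Set.mem_add, exists_exists_and_exists_and_eq_and]

/-- Adding the members of `l` to the numbers marked by the binary digits of `m`: the digits of the
result mark the sums. Shifting `m` by `a` adds `a` to each marked number. -/
def shiftMask (l : List ℕ) (m : ℕ) : ℕ := l.foldr (fun a s => m <<< a ||| s) 0

theorem testBit_shiftMask {l : List ℕ} {m n : ℕ} :
    (shiftMask l m).testBit n = true ↔ ∃ a ∈ l, a ≤ n ∧ m.testBit (n - a) = true := by
  induction l with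
  | nil => simp [shiftMask]
  | cons a l ih =>
    rw [shiftMask] at ih
    simp [shiftMask, ih]

/-- The number whose binary digits mark the sums `x + y + z` with `x ∈ l₁`, `y ∈ l₂`, `z ∈ l₃`. It
makes these sums quick to find by evaluation. -/
def sumMask (l₁ l₂ l₃ : List ℕ) : ℕ := shiftMask l₁ (shiftMask l₂ (shiftMask l₃ 1))

theorem testBit_sumMask {l₁ l₂ l₃ : List ℕ} {n : ℕ} :
    (sumMask l₁ l₂ l₃).testBit n = true ↔ ∃ x ∈ l₁, ∃ y ∈ l₂, ∃ z ∈ l₃, x + y + z = n := by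
  simp only [sumMask, testBit_shiftMask, Nat.testBit_one_eq_true_iff_self_eq_zero]
  constructor
  · rintro ⟨x, hx, hxn, y, hy, hyn, z, hz, hzn, h⟩
    exact ⟨x, hx, y, hy, z, hz, by omega⟩
  · rintro ⟨x, hx, y, hy, z, hz, rfl⟩
    exact ⟨x, hx, by omega, y, hy, by omega, z, hz, by omega, by omega⟩

theorem mem_add_add_of_testBit_sumMask {l₁ l₂ l₃ : List ℕ} {S T U : Set ℕ} {n : ℕ}
    (h₁ : ∀ x ∈ l₁, x ∈ S) (h₂ : ∀ y ∈ l₂, y ∈ T) (h₃ : ∀ z ∈ l₃, z ∈ U)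
    (hn : (sumMask l₁ l₂ l₃).testBit n = true) : n ∈ S + T + U := by
  obtain ⟨x, hx, y, hy, z, hz, h⟩ := testBit_sumMask.1 hn
  exact mem_add_add.2 ⟨x, h₁ x hx, y, h₂ y hy, z, h₃ z hz, h⟩

section DigitSteps

local notation "A" => pathNumbers 3 0

local notation "B" => pathNumbers 3 2

/-- The set `P` of the header: quotients `m` of sums `4 * m + 2` of three elements of `A`. The last
base-4 digits of the summands are `2, 0, 0` without carry, or `2, 2, 2` with carry `1`. -/
def quotientsTwo : Set ℕ :=
  {n | n ∈ A + B + B ∨ ∃ s ∈ A + A + A, s + 1 = n}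

/-- The set `Q` of the header: quotients `m` of sums `4 * m` of three elements of `A`. The last
base-4 digits of the summands are `0, 0, 0` without carry, or `2, 2, 0` with carry `1`. -/
def quotientsZero : Set ℕ :=
  {n | n ∈ B + B + B ∨ ∃ s ∈ A + A + B, s + 1 = n}

theorem mem_quotientsTwo {n : ℕ} :
    n ∈ quotientsTwo ↔ (∃ x ∈ A, ∃ y ∈ B, ∃ z ∈ B, x + y + z = n) ∨
      ∃ x ∈ A, ∃ y ∈ A, ∃ z ∈ A, x + y + z + 1 = n := by
  simp [quotientsTwo, mem_add_add, and_assoc]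

theorem mem_quotientsZero {n : ℕ} :
    n ∈ quotientsZero ↔ (∃ x ∈ B, ∃ y ∈ B, ∃ z ∈ B, x + y + z = n) ∨
      ∃ x ∈ A, ∃ y ∈ A, ∃ z ∈ B, x + y + z + 1 = n := by
  simp [quotientsZero, mem_add_add, and_assoc]

open pathNumbers

variable {m : ℕ}

theorem four_mul_add_two_mem_of_mem_quotientsTwo (hm : m ∈ quotientsTwo) :
    4 * m + 2 ∈ A + A + A := by
  refine mem_add_add.2 ?_
  rcases mem_quotientsTwo.1 hm with ⟨x, hx, y, hy, z, hz, rfl⟩ | ⟨x, hx, y, hy, z, hz, rfl⟩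
  · exact ⟨4 * x + 2, four_mul_add_two_mem hx, 4 * y, four_mul_mem hy, 4 * z, four_mul_mem hz,
      by ring⟩
  · exact ⟨4 * x + 2, four_mul_add_two_mem hx, 4 * y + 2, four_mul_add_two_mem hy,
      4 * z + 2, four_mul_add_two_mem hz, by ring⟩

theorem four_mul_mem_of_mem_quotientsZero (hm : m ∈ quotientsZero) : 4 * m ∈ A + A + A := by
  refine mem_add_add.2 ?_
  rcases mem_quotientsZero.1 hm with ⟨x, hx, y, hy, z, hz, rfl⟩ | ⟨x, hx, y, hy, z, hz, rfl⟩
  · exact ⟨4 * x, four_mul_mem hx, 4 * y, four_mul_mem hy, 4 * z, four_mul_mem hz, by ring⟩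
  · exact ⟨4 * x + 2, four_mul_add_two_mem hx, 4 * y + 2, four_mul_add_two_mem hy,
      4 * z, four_mul_mem hz, by ring⟩

theorem four_mul_add_one_mem_quotientsTwo (hm : m ∈ quotientsZero) : 4 * m + 1 ∈ quotientsTwo :=
  .inr ⟨4 * m, four_mul_mem_of_mem_quotientsZero hm, rfl⟩

theorem four_mul_add_two_mem_quotientsTwo (hm : m ∈ quotientsZero) :
    4 * m + 2 ∈ quotientsTwo := by
  refine mem_quotientsTwo.2 (.inl ?_)
  rcases mem_quotientsZero.1 hm with ⟨x, hx, y, hy, z, hz, rfl⟩ | ⟨x, hx, y, hy, z, hz, rfl⟩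
  · exact ⟨4 * x, four_mul_mem hx, 4 * y + 1, four_mul_add_one_mem hy,
      4 * z + 1, four_mul_add_one_mem hz, by ring⟩
  · exact ⟨4 * x + 2, four_mul_add_two_mem hx, 4 * y + 3, four_mul_add_three_mem hy,
      4 * z + 1, four_mul_add_one_mem hz, by ring⟩

theorem four_mul_add_three_mem_quotientsTwo (hm : m ∈ quotientsTwo) :
    4 * m + 3 ∈ quotientsTwo :=
  .inr ⟨4 * m + 2, four_mul_add_two_mem_of_mem_quotientsTwo hm, rfl⟩

theorem four_mul_add_four_mem_quotientsTwo (hm : m ∈ quotientsTwo) :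
    4 * m + 4 ∈ quotientsTwo := by
  refine mem_quotientsTwo.2 (.inl ?_)
  rcases mem_quotientsTwo.1 hm with ⟨x, hx, y, hy, z, hz, rfl⟩ | ⟨x, hx, y, hy, z, hz, rfl⟩
  · exact ⟨4 * x + 2, four_mul_add_two_mem hx, 4 * y + 1, four_mul_add_one_mem hy,
      4 * z + 1, four_mul_add_one_mem hz, by ring⟩
  · exact ⟨4 * x + 2, four_mul_add_two_mem hx, 4 * y + 3, four_mul_add_three_mem hy,
      4 * z + 3, four_mul_add_three_mem hz, by ring⟩

theorem four_mul_add_two_mem_quotientsZero (hm : m ∈ quotientsZero) :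
    4 * m + 2 ∈ quotientsZero := by
  refine mem_quotientsZero.2 (.inr ?_)
  rcases mem_quotientsZero.1 hm with ⟨x, hx, y, hy, z, hz, rfl⟩ | ⟨x, hx, y, hy, z, hz, rfl⟩
  · exact ⟨4 * x, four_mul_mem hx, 4 * y, four_mul_mem hy, 4 * z + 1, four_mul_add_one_mem hz,
      by ring⟩
  · exact ⟨4 * x + 2, four_mul_add_two_mem hx, 4 * y + 2, four_mul_add_two_mem hy,
      4 * z + 1, four_mul_add_one_mem hz, by ring⟩

theorem four_mul_add_three_mem_quotientsZero (hm : m ∈ quotientsZero) :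
    4 * m + 3 ∈ quotientsZero := by
  refine mem_quotientsZero.2 (.inl ?_)
  rcases mem_quotientsZero.1 hm with ⟨x, hx, y, hy, z, hz, rfl⟩ | ⟨x, hx, y, hy, z, hz, rfl⟩
  · exact ⟨4 * x + 1, four_mul_add_one_mem hx, 4 * y + 1, four_mul_add_one_mem hy,
      4 * z + 1, four_mul_add_one_mem hz, by ring⟩
  · exact ⟨4 * x + 3, four_mul_add_three_mem hx, 4 * y + 3, four_mul_add_three_mem hy,
      4 * z + 1, four_mul_add_one_mem hz, by ring⟩

theorem four_mul_add_four_mem_quotientsZero (hm : m ∈ quotientsTwo) :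
    4 * m + 4 ∈ quotientsZero := by
  refine mem_quotientsZero.2 (.inr ?_)
  rcases mem_quotientsTwo.1 hm with ⟨x, hx, y, hy, z, hz, rfl⟩ | ⟨x, hx, y, hy, z, hz, rfl⟩
  · exact ⟨4 * y, four_mul_mem hy, 4 * z, four_mul_mem hz, 4 * x + 3, four_mul_add_three_mem hx,
      by ring⟩
  · exact ⟨4 * x + 2, four_mul_add_two_mem hx, 4 * y + 2, four_mul_add_two_mem hy,
      4 * z + 3, four_mul_add_three_mem hz, by ring⟩

theorem four_mul_add_five_mem_quotientsZero (hm : m ∈ quotientsTwo) :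
    4 * m + 5 ∈ quotientsZero := by
  refine mem_quotientsZero.2 (.inl ?_)
  rcases mem_quotientsTwo.1 hm with ⟨x, hx, y, hy, z, hz, rfl⟩ | ⟨x, hx, y, hy, z, hz, rfl⟩
  · exact ⟨4 * x + 3, four_mul_add_three_mem hx, 4 * y + 1, four_mul_add_one_mem hy,
      4 * z + 1, four_mul_add_one_mem hz, by ring⟩
  · exact ⟨4 * x + 3, four_mul_add_three_mem hx, 4 * y + 3, four_mul_add_three_mem hy,
      4 * z + 3, four_mul_add_three_mem hz, by ring⟩

theorem mem_quotients_of_le {c : ℕ}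
    (base : ∀ n, c ≤ n → n < 4 * c + 4 → n ∈ quotientsTwo ∧ n ∈ quotientsZero) {n : ℕ}
    (hn : c ≤ n) : n ∈ quotientsTwo ∧ n ∈ quotientsZero := by
  induction n using Nat.strong_induction_on with
  | _ n ih =>
    rcases lt_or_ge n (4 * c + 4) with hlt | hge
    · exact base n hn hlt
    obtain ⟨m, hm, hm_lt, hr⟩ : ∃ m, c ≤ m ∧ m + 1 < n ∧
        (n = 4 * m + 4 ∨ n = 4 * m + 5 ∨ n = 4 * m + 6 ∨ n = 4 * m + 7) :=
      ⟨n / 4 - 1, by omega, by omega, by omega⟩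
    obtain ⟨two, -⟩ := ih m (by omega) hm
    obtain ⟨two', zero'⟩ := ih (m + 1) hm_lt (by omega)
    rcases hr with rfl | rfl | rfl | rfl
    · exact ⟨four_mul_add_four_mem_quotientsTwo two, four_mul_add_four_mem_quotientsZero two⟩
    · exact ⟨four_mul_add_one_mem_quotientsTwo zero', four_mul_add_five_mem_quotientsZero two⟩
    · exact ⟨four_mul_add_two_mem_quotientsTwo zero', four_mul_add_two_mem_quotientsZero zero'⟩
    · exact ⟨four_mul_add_three_mem_quotientsTwo two', four_mul_add_three_mem_quotientsZero zero'⟩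

/-- The elements of `A` and of `B` with at most `k` base-4 digits, generated by appending digits. -/
def pathLists : ℕ → List ℕ × List ℕ
  | 0 => ([0], [])
  | k + 1 =>
    let (a, b) := pathLists k
    (0 :: a.map (4 * · + 2) ++ b.map (4 * ·),
      a.map (4 * · + 3) ++ b.map (4 * · + 1) ++ b.map (4 * · + 2))

theorem mem_of_mem_pathLists (k : ℕ) :
    (∀ a ∈ (pathLists k).1, a ∈ A) ∧ ∀ b ∈ (pathLists k).2, b ∈ B := by
  induction k with
  | zero => simp [pathLists, zero_mem]
  | succ k ih =>
    simp only [pathLists, List.mem_append, List.mem_cons, List.mem_map]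
    constructor
    · rintro _ ((rfl | ⟨a, ha, rfl⟩) | ⟨b, hb, rfl⟩)
      exacts [zero_mem, four_mul_add_two_mem (ih.1 a ha), four_mul_mem (ih.2 b hb)]
    · rintro _ ((⟨a, ha, rfl⟩ | ⟨b, hb, rfl⟩) | ⟨b, hb, rfl⟩)
      exacts [four_mul_add_three_mem (ih.1 a ha), four_mul_add_one_mem (ih.2 b hb),
        four_mul_add_two_mem (ih.2 b hb)]

theorem mem_quotients_of_lt {n : ℕ} (hc : 182 ≤ n) (hn : n < 4 * 182 + 4) :
    n ∈ quotientsTwo ∧ n ∈ quotientsZero := by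
  let a := (pathLists 5).1
  let b := (pathLists 5).2
  have masks : ∀ n < 4 * 182 + 4, 182 ≤ n →
      ((sumMask a b b).testBit n = true ∨ (sumMask a a a).testBit (n - 1) = true) ∧
      ((sumMask b b b).testBit n = true ∨ (sumMask a a b).testBit (n - 1) = true) := by
    decide +kernel
  obtain ⟨ha, hb⟩ := mem_of_mem_pathLists 5
  exact (masks n hn hc).imp
    (.imp (mem_add_add_of_testBit_sumMask ha hb hb) fun h =>
      ⟨n - 1, mem_add_add_of_testBit_sumMask ha ha ha h, by omega⟩)
    (.imp (mem_add_add_of_testBit_sumMask hb hb hb) fun h =>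
      ⟨n - 1, mem_add_add_of_testBit_sumMask ha ha hb h, by omega⟩)

theorem mem_add_add_of_even_of_lt {n : ℕ} (he : Even n)
    (hn : n ∉ ({8, 18, 28, 38, 40, 82, 166} : Set ℕ)) (hlt : n < 728) : n ∈ A + A + A := by
  let a := (pathLists 5).1
  have masks : ∀ n < 728, Even n → n ∉ ({8, 18, 28, 38, 40, 82, 166} : Set ℕ) →
      (sumMask a a a).testBit n = true := by
    decide +kernel
  have ha := (mem_of_mem_pathLists 5).1
  exact mem_add_add_of_testBit_sumMask ha ha ha (masks n hlt he hn)

theorem mem_add_add_of_even {n : ℕ} (he : Even n)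
    (hn : n ∉ ({8, 18, 28, 38, 40, 82, 166} : Set ℕ)) : n ∈ A + A + A := by
  rcases lt_or_ge n 728 with hlt | hge
  · exact mem_add_add_of_even_of_lt he hn hlt
  obtain ⟨m, hm, rfl | rfl⟩ : ∃ m, 182 ≤ m ∧ (n = 4 * m ∨ n = 4 * m + 2) :=
    ⟨n / 4, by omega, by grind⟩
  all_goals have hquot := mem_quotients_of_le (fun _ => mem_quotients_of_lt) hm
  · exact four_mul_mem_of_mem_quotientsZero hquot.2
  · exact four_mul_add_two_mem_of_mem_quotientsTwo hquot.1

end DigitSteps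

namespace IsSumOfAtMost

theorem mono {k n : ℕ} {S T : Set ℕ} (h : S ⊆ T) (hn : IsSumOfAtMost k S n) :
    IsSumOfAtMost k T n := by
  obtain ⟨l, hl, hS, hsum⟩ := hn
  exact ⟨l, hl, fun s hs => h (hS s hs), hsum⟩

theorem three_iff_mem_add {S : Set ℕ} (h0 : 0 ∈ S) {n : ℕ} :
    IsSumOfAtMost 3 S n ↔ n ∈ S + S + S := by
  rw [mem_add_add]
  constructor
  · rintro ⟨l, hl, hS, rfl⟩
    match l, hl, hS with
    | [], _, _ => exact ⟨0, h0, 0, h0, 0, h0, rfl⟩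
    | [x], _, hS => exact ⟨x, hS x (by simp), 0, h0, 0, h0, by simp⟩
    | [x, y], _, hS => exact ⟨x, hS x (by simp), y, hS y (by simp), 0, h0, by simp⟩
    | [x, y, z], _, hS =>
      exact ⟨x, hS x (by simp), y, hS y (by simp), z, hS z (by simp), by simp [add_assoc]⟩
  · rintro ⟨x, hx, y, hy, z, hz, rfl⟩
    exact ⟨[x, y, z], by simp, by simp [hx, hy, hz], by simp [add_assoc]⟩

end IsSumOfAtMost

namespace totallyBalancedNumbers

instance : DecidablePred (· ∈ totallyBalancedNumbers) := fun n =>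
  inferInstanceAs (Decidable (TotallyBalanced (binaryWord n)))

theorem not_isSumOfAtMost_three {n : ℕ} (hn : n ∈ ({8, 18, 28, 38, 40, 82, 166} : Set ℕ)) :
    ¬ IsSumOfAtMost 3 totallyBalancedNumbers n := by
  let l := (List.range 167).filter (· ∈ totallyBalancedNumbers)
  have masks : ∀ n ∈ [8, 18, 28, 38, 40, 82, 166], ¬ (sumMask l l l).testBit n = true := by
    decide +kernel
  have hlt : n < 167 := by
    simp only [Set.mem_insert_iff, Set.mem_singleton_iff] at hn
    omega
  rw [IsSumOfAtMost.three_iff_mem_add (by decide), mem_add_add]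
  rintro ⟨x, hx, y, hy, z, hz, rfl⟩
  have mem_l {s : ℕ} (hs : s ∈ totallyBalancedNumbers) (hlt : s < 167) : s ∈ l := by
    simpa [l] using ⟨hlt, hs⟩
  exact masks _ (by simpa using hn) (testBit_sumMask.2
    ⟨x, mem_l hx (by omega), y, mem_l hy (by omega), z, mem_l hz (by omega), rfl⟩)

theorem two_pow_notMem {k : ℕ} (hk : 2 ≤ k) : 2 ^ k ∉ totallyBalancedNumbers := by
  intro h
  have count_true : (binaryWord (2 ^ k)).count true = 1 := by
    simp [binaryWord_two_pow, List.count_replicate]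
  have count_false : (binaryWord (2 ^ k)).count false = k := by simp [binaryWord_two_pow]
  have hcount : (binaryWord (2 ^ k)).count true = (binaryWord (2 ^ k)).count false := h.1
  omega

theorem even_size {s : ℕ} (hs : s ∈ totallyBalancedNumbers) : Even s.size :=
  length_binaryWord s ▸ TotallyBalanced.even_length hs

theorem lt_two_pow {m s : ℕ} (hm : 1 ≤ m) (hs : s ∈ totallyBalancedNumbers)
    (hle : s ≤ 2 ^ (2 * m + 1)) : s < 2 ^ (2 * m) := by
  have hne : s ≠ 2 ^ (2 * m + 1) := by
    rintro rfl
    exact two_pow_notMem (by omega) hs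
  have hsize : s.size ≤ 2 * m + 1 := Nat.size_le.2 (by omega)
  obtain ⟨r, hr⟩ := even_size hs
  exact Nat.size_le.1 (by omega)

theorem not_isSumOfAtMost_two_two_pow {m : ℕ} (hm : 1 ≤ m) :
    ¬ IsSumOfAtMost 2 totallyBalancedNumbers (2 ^ (2 * m + 1)) := by
  rintro ⟨l, hl, hS, hsum⟩
  have summand_le : ∀ s ∈ l, s ≤ 2 ^ (2 * m) - 1 := fun s hs =>
    Nat.le_sub_one_of_lt (lt_two_pow hm (hS s hs) (hsum ▸ List.single_le_sum (by simp) s hs))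
  have hpos : 0 < 2 ^ (2 * m) := by positivity
  have : 2 ^ (2 * m + 1) < 2 ^ (2 * m + 1) := calc
    2 ^ (2 * m + 1) = l.sum := hsum.symm
    _ ≤ l.length * (2 ^ (2 * m) - 1) := List.sum_le_card_nsmul l _ summand_le
    _ ≤ 2 * (2 ^ (2 * m) - 1) := Nat.mul_le_mul_right _ hl
    _ < 2 ^ (2 * m + 1) := by rw [pow_succ]; omega
  exact this.false

theorem infinite_even_not_isSumOfAtMost_two :
    {n : ℕ | Even n ∧ ¬ IsSumOfAtMost 2 totallyBalancedNumbers n}.Infinite := by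
  refine Set.infinite_of_injective_forall_mem (f := fun m : ℕ => 2 ^ (2 * (m + 1) + 1))
    (fun a b h => ?_) fun m => ⟨even_two.pow_of_ne_zero (by omega),
      not_isSumOfAtMost_two_two_pow (by omega)⟩
  have := Nat.pow_right_injective le_rfl h
  omega

end totallyBalancedNumbers

theorem isSumOfAtMost_three_iff_notMem_exceptions {S : Set ℕ} (hA : pathNumbers 3 0 ⊆ S)
    (hS : S ⊆ totallyBalancedNumbers) {n : ℕ} (he : Even n) :
    IsSumOfAtMost 3 S n ↔ n ∉ ({8, 18, 28, 38, 40, 82, 166} : Set ℕ) :=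
  ⟨fun h hn => totallyBalancedNumbers.not_isSumOfAtMost_three hn (h.mono hS), fun hn =>
    ((IsSumOfAtMost.three_iff_mem_add pathNumbers.zero_mem).2 (mem_add_add_of_even he hn)).mono hA⟩

theorem mainTheorem7 :
    (∀ n : ℕ, Even n →
      (IsSumOfAtMost 3 totallyBalancedNumbers n ↔
        n ∉ ({8, 18, 28, 38, 40, 82, 166} : Set ℕ))) ∧
    {n : ℕ | Even n ∧ ¬ IsSumOfAtMost 2 totallyBalancedNumbers n}.Infinite ∧
    (∀ n : ℕ, Even n →
      (IsSumOfAtMost 3 {s : ℕ | binaryWord s ∈ balancedLevelThree} n ↔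
        n ∉ ({8, 18, 28, 38, 40, 82, 166} : Set ℕ))) := by
  have level_subset : {s | binaryWord s ∈ balancedLevelThree} ⊆ totallyBalancedNumbers :=
    fun _ hs => hs.1
  have path_subset := pathNumbers.subset_balancedLevelThree
  exact ⟨fun _ => isSumOfAtMost_three_iff_notMem_exceptions (path_subset.trans level_subset) le_rfl,
    totallyBalancedNumbers.infinite_even_not_isSumOfAtMost_two,
    fun _ => isSumOfAtMost_three_iff_notMem_exceptions path_subset level_subset⟩
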